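/- Let $n\ge 2$. The partition monoid $\mathcal P_n$ consists of all set partitions $\alpha$ of $\{1,\dots,n\}\cup\{1',\dots,n'\}$. The product $\alpha\beta$ is obtained by placing $\alpha$ above $\beta$ and identifying the lower vertices of $\alpha$ with the upper vertices of $\beta$ to form a middle row: two of the remaining vertices lie in the same block of $\alpha\beta$ iff they lie in the same connected component of the resulting graph. Write $\alpha^*$ for the partition obtained from $\alpha$ by interchanging $i$ and $i'$ for every $i$. Put $\ker(\alpha)=\{(x,y)\in\{1,\dots,n\}^2 : x,y\text{ lie in the same block of }\alpha\}$, and let $\operatorname{rank}(\alpha)$ be the number of blocks of $\alpha$ containing both dashed and undashed vertices. Let $M$ be one of the following submonoids of $\mathcal P_n$, all closed under $*$: $\mathcal P_n$ itself; the partial Brauer monoid $\mathcal{PB}_n$ (all blocks have size at most $2$); the planar partition monoid $\mathcal{PP}_n$ (partitions whose blocks are the connected components of a graph that can be drawn without crossings inside the rectangle spanned by the vertices, with $1<\dots<n$ on the top edge and $1'<\dots<n'$ on the bottom edge); the Motzkin monoid $\mathcal M_n=\mathcal{PP}_n\cap\mathcal{PB}_n$. Let $$Q=\{\varepsilon\in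 M : \varepsilon^2=\varepsilon=\varepsilon^*,\ \operatorname{rank}(\varepsilon)\le 2\},$$ let $-$ be a symbol not in $Q$, and let $Q^-=Q\cup\{-\}$. Let $\mu:Q^-\times M\to Q^-$ be the right action of $M$ given by $\mu(-,\alpha)=-$ and, for $\varepsilon\in Q$, $$\mu(\varepsilon,\alpha)=\begin{cases}\alpha^*\varepsilon\alpha & \text{if }\ker(\varepsilon)=\ker(\varepsilon\alpha),\\ - & \text{otherwise.}\end{cases}$$ For a semigroup $S$, a right action of $S$ on a set $X$ is faithful if distinct elements of $S$ induce distinct maps on $X$, and monogenic if $X=\{x\}\cup xS$ for some $x\in X$; it is a right congruence action if it is isomorphic to the action $[y]a=[ya]$ of $S$ on $S/\sigma$ for some right congruence $\sigma$ of $S$. Let $\deg(S)$ be the least $m\ge1$ such that $S$ embeds, as a semigroup, in the monoid of all self-maps of an $m$-element set (maps being composed from left to right), and let $\deg_{\mathrm{rc}}(S)$ be the least $m\ge 1$ such that $S$ has a faithful right congruence action on a set of size $m$ (each is $\infty$ if there is no such $m$). Then $\mu$ is faithful and monogenic, and $$\deg(M)\le\deg_{\mathrm{rc}}(M)\le 1+|Q|.$$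 -/

import Mathlib

namespace Diag

/-! ### Semigroup actions, right congruences and transformation degrees -/

/-- A (right) action of a semigroup `S` on a set `X`. -/
structure RightAction (X : Type*) (S : Type*) [Semigroup S] where
  act : X → S → X
  act_mul : ∀ (x : X) (a b : S), act (act x a) b = act x (a * b)

namespace RightAction

/-- The representation `a ↦ (x ↦ x a)` is injective. -/
def Faithful {X S : Type*} [Semigroup S] (μ : RightAction X S) : Prop :=
  Function.Injective (fun (a : S) (x : X) => μ.act x a)

/-- The sub-act generated by a subset `Y`. -/
def generated {X S : Type*} [Semigroup S] (μ : RightAction X S) (Y : Set X) : Set X :=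
  Y ∪ {z | ∃ y ∈ Y, ∃ a : S, z = μ.act y a}

/-- The action is generated by a single point. -/
def Monogenic {X S : Type*} [Semigroup S] (μ : RightAction X S) : Prop :=
  ∃ x : X, μ.generated {x} = Set.univ

/-- Isomorphism of actions of the same semigroup. -/
def Isomorphic {X Y S : Type*} [Semigroup S] (μ : RightAction X S) (ν : RightAction Y S) :
    Prop :=
  ∃ ξ : X ≃ Y, ∀ (x : X) (a : S), ξ (μ.act x a) = ν.act (ξ x) a

end RightAction

/-- A right-compatible equivalence relation. -/
def IsRightCongruence {S : Type*} [Semigroup S] (σ : Setoid S) : Prop :=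
  ∀ a b s : S, σ a b → σ (a * s) (b * s)

/-- The action `[x] a = [x a]` of `S` on the classes of a right congruence. -/
def congruenceAction {S : Type*} [Semigroup S] (σ : Setoid S) (hσ : IsRightCongruence σ) :
    RightAction (Quotient σ) S where
  act x a := Quotient.map (fun y => y * a) (fun _ _ h => hσ _ _ a h) x
  act_mul := by
    intro x a b
    induction x using Quotient.inductionOn with
    | _ x => simp [mul_assoc]

/-- An action isomorphic to the action on the classes of some right congruence. -/
def RightAction.IsRightCongruenceAction {X S : Type*} [Semigroup S] (μ : RightAction X S) :
    Prop :=
  ∃ (σ : Setoid S) (hσ : IsRightCongruence σ), μ.Isomorphic (congruenceAction σ hσ)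

/-- The minimum transformation degree: the least `m ≥ 1` for which `S` embeds, as a semigroup,
in the full transformation monoid on `m` points (maps composed from left to right).
The value is `⊤` if there is no such `m`. -/
noncomputable def deg (S : Type*) [Semigroup S] : ℕ∞ :=
  ⨅ m ∈ {m : ℕ | 1 ≤ m ∧
    ∃ φ : S →ₙ* (Function.End (Fin m))ᵐᵒᵖ, Function.Injective φ}, (m : ℕ∞)

/-- The minimum right congruence degree: the least `m ≥ 1` for which `S` has a faithful right
congruence action on a set of size `m`. The value is `⊤` if there is no such `m`. -/
noncomputable def degRC.{u} (S : Type u) [Semigroup S] : ℕ∞ :=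
  ⨅ m ∈ {m : ℕ | 1 ≤ m ∧ ∃ (X : Type u) (μ : RightAction X S),
    Nat.card X = m ∧ μ.Faithful ∧ μ.IsRightCongruenceAction}, (m : ℕ∞)

/-! ### Partitions and their product -/

/-- A set partition of the `2n` vertices: `Sum.inl i` is the upper vertex `i`, and `Sum.inr i` is
the lower vertex `i'`. -/
@[ext]
structure Partn (n : ℕ) where
  rel : Setoid (Fin n ⊕ Fin n)

/-- The three rows of vertices of a product graph. -/
inductive Vertex3 (n : ℕ) where
  | upper (i : Fin n)
  | middle (i : Fin n)
  | lower (i : Fin n)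

namespace Partn

variable {n : ℕ}

/-- The edges of the product graph of `α` and `β`: `α` is placed on the upper and middle rows and
`β` on the middle and lower rows. -/
def ProductEdge (α β : Partn n) (x y : Vertex3 n) : Prop :=
  (∃ a b, α.rel a b ∧ x = Sum.elim .upper .middle a ∧ y = Sum.elim .upper .middle b) ∨
  (∃ a b, β.rel a b ∧ x = Sum.elim .middle .lower a ∧ y = Sum.elim .middle .lower b)

/-- Two vertices are in the same block of `α * β` iff they are in the same connected component of
the product graph. -/
instance : Mul (Partn n) where
  mul α β := ⟨(Relation.EqvGen.setoid (ProductEdge α β)).comap (Sum.elim .upper .lower)⟩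

/-- The identity: the blocks are `{i, i'}`. -/
instance : One (Partn n) where
  one := ⟨Setoid.ker (Sum.elim id id)⟩

/-- The involution interchanging the upper and lower rows. -/
instance : Star (Partn n) where
  star α := ⟨α.rel.comap Sum.swap⟩

/-- The kernel: `x` and `y` are related iff the upper vertices `x`, `y` are in the same block. -/
def ker (α : Partn n) : Setoid (Fin n) := α.rel.comap Sum.inl

/-- The blocks that contain both upper and lower vertices. -/
def transversals (α : Partn n) : Set (Set (Fin n ⊕ Fin n)) :=
  {B | B ∈ α.rel.classes ∧ (∃ i, Sum.inl i ∈ B) ∧ ∃ j, Sum.inr j ∈ B}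

/-- The number of transversals. -/
noncomputable def rank (α : Partn n) : ℕ := α.transversals.ncard

/-- Every block has size at most two. -/
def IsPartialBrauer (α : Partn n) : Prop := ∀ B ∈ α.rel.classes, B.ncard ≤ 2

/-- The position of a vertex on the boundary of the rectangle, read
`1, …, n` along the top and then `n', …, 1'` along the bottom. -/
def boundaryPos (x : Fin n ⊕ Fin n) : ℕ :=
  Sum.elim (fun i : Fin n => (i : ℕ)) (fun i : Fin n => 2 * n - 1 - (i : ℕ)) x

/-- A partition is planar if its blocks are the connected components of a graph that can be drawn
in the rectangle without crossings. All vertices lie on the boundary of the rectangle, so edges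
can be so drawn precisely when no two of them have interleaved end points along the boundary. -/
def IsPlanar (α : Partn n) : Prop :=
  ∃ G : SimpleGraph (Fin n ⊕ Fin n), (∀ x y, G.Reachable x y ↔ α.rel x y) ∧
    ∀ a b c d, boundaryPos a < boundaryPos b → boundaryPos b < boundaryPos c →
      boundaryPos c < boundaryPos d → G.Adj a c → ¬ G.Adj b d

/-! ### Auxiliary facts: the monoid structure -/

/-- A pair of subsets of the two rows that is a union of blocks. -/
def Compat (α : Partn n) (u l : Fin n → Prop) : Prop :=
  ∀ a b, α.rel a b → (Sum.elim u l a ↔ Sum.elim u l b)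

theorem compat_class (α : Partn n) (x : Fin n ⊕ Fin n) :
    α.Compat (fun i => α.rel x (.inl i)) (fun j => α.rel x (.inr j)) := by
  have key : ∀ a, Sum.elim (fun i => α.rel x (.inl i)) (fun j => α.rel x (.inr j)) a
      = α.rel x a := by rintro (a | a) <;> rfl
  intro a b h
  rw [key, key]
  exact ⟨fun h1 => α.rel.trans' h1 h, fun h1 => α.rel.trans' h1 (α.rel.symm' h)⟩

theorem rel_iff (α : Partn n) (x y : Fin n ⊕ Fin n) :
    α.rel x y ↔ ∀ u l, α.Compat u l → (Sum.elim u l x ↔ Sum.elim u l y) := by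
  refine ⟨fun h u l hc => hc _ _ h, fun h => ?_⟩
  have key : ∀ a, Sum.elim (fun i => α.rel x (.inl i)) (fun j => α.rel x (.inr j)) a
      = α.rel x a := by rintro (a | a) <;> rfl
  have := h _ _ (α.compat_class x)
  rw [key, key] at this
  exact this.1 (α.rel.refl' x)

theorem ext_compat {α β : Partn n} (h : ∀ u l, α.Compat u l ↔ β.Compat u l) : α = β := by
  apply Partn.ext
  ext x y
  rw [rel_iff, rel_iff]
  simp only [h]

theorem compat_mul (α β : Partn n) (u l : Fin n → Prop) :
    (α * β).Compat u l ↔ ∃ m, α.Compat u m ∧ β.Compat m l := by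
  have hmul : ∀ x y, (α * β).rel x y ↔ Relation.EqvGen (ProductEdge α β)
    (Sum.elim .upper .lower x) (Sum.elim .upper .lower y) := fun _ _ => Iff.rfl
  constructor
  · intro h
    let f : Vertex3 n → Prop := fun v => ∃ a : Fin n ⊕ Fin n,
      Relation.EqvGen (ProductEdge α β) (Sum.elim .upper .lower a) v ∧ Sum.elim u l a
    have hf : ∀ v w, ProductEdge α β v w → (f v ↔ f w) := fun v w hvw =>
      ⟨fun ⟨a, h1, h2⟩ => ⟨a, h1.trans _ _ _ (.rel _ _ hvw), h2⟩,
       fun ⟨a, h1, h2⟩ => ⟨a, h1.trans _ _ _ (.symm _ _ (.rel _ _ hvw)), h2⟩⟩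
    have hfo : ∀ a : Fin n ⊕ Fin n, f (Sum.elim .upper .lower a) ↔ Sum.elim u l a := fun a =>
      ⟨fun ⟨b, h1, h2⟩ => (h b a ((hmul b a).2 h1)).1 h2, fun h2 => ⟨a, .refl _, h2⟩⟩
    refine ⟨fun i => f (.middle i), fun a b hab => ?_, fun a b hab => ?_⟩
    · have := hf _ _ (Or.inl ⟨a, b, hab, rfl, rfl⟩)
      have h1 : ∀ a, f (Sum.elim .upper .middle a) ↔ Sum.elim u (fun i => f (.middle i)) a := by
        rintro (a | a)
        · exact hfo (.inl a)
        · rfl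
      rwa [h1, h1] at this
    · have := hf _ _ (Or.inr ⟨a, b, hab, rfl, rfl⟩)
      have h1 : ∀ a, f (Sum.elim .middle .lower a) ↔ Sum.elim (fun i => f (.middle i)) l a := by
        rintro (a | a)
        · rfl
        · exact hfo (.inr a)
      rwa [h1, h1] at this
  · rintro ⟨m, h1, h2⟩ a b hab
    let f : Vertex3 n → Prop := fun v => match v with
      | .upper i => u i
      | .middle i => m i
      | .lower i => l i
    have hout : ∀ a, Sum.elim u l a ↔ f (Sum.elim .upper .lower a) := by rintro (a | a) <;> rfl
    have htop : ∀ a, Sum.elim u m a ↔ f (Sum.elim .upper .middle a) := by rintro (a | a) <;> rfl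
    have hbot : ∀ a, Sum.elim m l a ↔ f (Sum.elim .middle .lower a) := by rintro (a | a) <;> rfl
    rw [hout, hout]
    rw [hmul] at hab
    generalize (Sum.elim Vertex3.upper Vertex3.lower a) = v at hab
    generalize (Sum.elim Vertex3.upper Vertex3.lower b) = w at hab
    induction hab with
    | rel v w h =>
      rcases h with ⟨a, b, hab, rfl, rfl⟩ | ⟨a, b, hab, rfl, rfl⟩
      · rw [← htop, ← htop]; exact h1 _ _ hab
      · rw [← hbot, ← hbot]; exact h2 _ _ hab
    | refl => rfl
    | symm _ _ _ ih => exact ih.symm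
    | trans _ _ _ _ _ ih1 ih2 => exact ih1.trans ih2

theorem compat_one (u l : Fin n → Prop) : (1 : Partn n).Compat u l ↔ u = l := by
  have hone : ∀ x y, (1 : Partn n).rel x y ↔ (Sum.elim id id x : Fin n) = Sum.elim id id y :=
    fun _ _ => Iff.rfl
  constructor
  · intro h
    funext i
    exact propext (h (.inl i) (.inr i) ((hone _ _).2 rfl))
  · rintro rfl a b h
    rw [hone] at h
    rcases a with a | a <;> rcases b with b | b <;> simp_all

theorem compat_star (α : Partn n) (u l : Fin n → Prop) :
    (star α).Compat u l ↔ α.Compat l u := by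
  have hstar : ∀ x y, (star α).rel x y ↔ α.rel x.swap y.swap := fun _ _ => Iff.rfl
  have h1 : ∀ a : Fin n ⊕ Fin n, Sum.elim u l a ↔ Sum.elim l u a.swap := by
    rintro (a | a) <;> rfl
  constructor
  · intro h a b hab
    have := h a.swap b.swap (by rw [hstar]; simpa using hab)
    rw [h1, h1] at this
    simpa using this
  · intro h a b hab
    rw [h1, h1]
    exact h _ _ hab

instance : Monoid (Partn n) where
  mul_assoc α β γ := by
    apply ext_compat
    intro u l
    simp only [compat_mul]
    constructor
    · rintro ⟨m, ⟨k, h1, h2⟩, h3⟩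
      exact ⟨k, h1, m, h2, h3⟩
    · rintro ⟨k, h1, m, h2, h3⟩
      exact ⟨m, ⟨k, h1, h2⟩, h3⟩
  one_mul α := by
    apply ext_compat
    intro u l
    simp [compat_mul, compat_one]
  mul_one α := by
    apply ext_compat
    intro u l
    simp [compat_mul, compat_one]

instance : StarMul (Partn n) where
  star_involutive α := by
    apply ext_compat
    intro u l
    simp only [compat_star]
  star_mul α β := by
    apply ext_compat
    intro u l
    simp only [compat_star, compat_mul]
    exact exists_congr fun m => and_comm

theorem mul_star_mul (α : Partn n) : α * star α * α = α := by
  apply ext_compat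
  intro u l
  simp only [compat_mul, compat_star]
  constructor
  · rintro ⟨k, ⟨m, h1, h2⟩, h3⟩ a b hab
    have e1 := h1 a b hab
    have e2 := h2 a b hab
    have e3 := h3 a b hab
    rcases a with a | a <;> rcases b with b | b <;> simp_all
  · intro h
    exact ⟨u, ⟨l, h, h⟩, h⟩

theorem exists_compat_iff (α : Partn n) (u : Fin n → Prop) :
    (∃ l, α.Compat u l) ↔ ∀ x y, α.ker x y → (u x ↔ u y) := by
  constructor
  · rintro ⟨l, h⟩ x y hxy
    exact h (.inl x) (.inl y) hxy
  · intro h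
    refine ⟨fun j => ∃ i, α.rel (.inl i) (.inr j) ∧ u i, ?_⟩
    have h' : ∀ x y, α.rel (.inl x) (.inl y) → u x → u y := fun x y hxy => (h x y hxy).1
    rintro (a | a) (b | b) hab
    · exact h a b hab
    · exact ⟨fun hu => ⟨a, hab, hu⟩,
        fun ⟨i, h1, h2⟩ => h' _ _ (α.rel.trans' h1 (α.rel.symm' hab)) h2⟩
    · exact ⟨fun ⟨i, h1, h2⟩ => h' _ _ (α.rel.trans' h1 hab) h2,
        fun hu => ⟨b, α.rel.symm' hab, hu⟩⟩
    · exact ⟨fun ⟨i, h1, h2⟩ => ⟨i, α.rel.trans' h1 hab, h2⟩,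
        fun ⟨i, h1, h2⟩ => ⟨i, α.rel.trans' h1 (α.rel.symm' hab), h2⟩⟩

theorem ker_le_iff (α β : Partn n) :
    α.ker ≤ β.ker ↔ ∀ u, (∃ l, β.Compat u l) → ∃ l, α.Compat u l := by
  simp only [exists_compat_iff]
  constructor
  · intro h u hu x y hxy
    exact hu x y (h hxy)
  · intro h x y hxy
    refine (h (fun z => β.ker x z) (fun y z hyz => ?_) x y hxy).1 (β.ker.refl' x)
    exact ⟨fun h1 => β.ker.trans' h1 hyz, fun h1 => β.ker.trans' h1 (β.ker.symm' hyz)⟩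

theorem ker_le_ker_mul (α β : Partn n) : α.ker ≤ (α * β).ker := by
  rw [ker_le_iff]
  rintro u ⟨l, h⟩
  obtain ⟨m, h1, -⟩ := (compat_mul _ _ _ _).1 h
  exact ⟨m, h1⟩

theorem ker_mul_le (γ : Partn n) {α β : Partn n} (h : α.ker ≤ β.ker) :
    (γ * α).ker ≤ (γ * β).ker := by
  rw [ker_le_iff] at h ⊢
  rintro u ⟨l, hl⟩
  obtain ⟨m, h1, h2⟩ := (compat_mul _ _ _ _).1 hl
  obtain ⟨k, hk⟩ := h m ⟨l, h2⟩
  exact ⟨k, (compat_mul _ _ _ _).2 ⟨m, h1, hk⟩⟩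

/-! ### Auxiliary facts: the rank -/

theorem rank_mul_le (α β : Partn n) : (α * β).rank ≤ α.rank := by
  classical
  let g : Set (Fin n ⊕ Fin n) → Set (Fin n ⊕ Fin n) := fun B =>
    if h : ∃ i, Sum.inl i ∈ B then {y | α.rel y (.inl h.choose)} else ∅
  have hmem : ∀ B ∈ (α * β).transversals, ∃ i, Sum.inl i ∈ B ∧ g B = {y | α.rel y (.inl i)} := by
    rintro B ⟨-, h, -⟩
    exact ⟨h.choose, h.choose_spec, by simp only [g, dif_pos h]⟩
  have hcls : ∀ B ∈ (α * β).transversals, ∀ x ∈ B, B = {y | (α * β).rel y x} := by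
    rintro B ⟨⟨z, rfl⟩, -⟩ x hx
    ext y
    exact ⟨fun h => (α * β).rel.trans' h ((α * β).rel.symm' hx),
      fun h => (α * β).rel.trans' h hx⟩
  refine Set.ncard_le_ncard_of_injOn g ?_ ?_ (Set.toFinite _)
  · intro B hB
    obtain ⟨i, hi, hg⟩ := hmem B hB
    have hB' := hcls B hB _ hi
    obtain ⟨-, -, j, hj⟩ := hB
    rw [hg]
    refine ⟨⟨_, rfl⟩, ⟨i, α.rel.refl' _⟩, ?_⟩
    by_contra hno
    push Not at hno
    have hα : α.Compat (fun k => α.rel (.inl i) (.inl k)) (fun _ => False) := by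
      have := α.compat_class (.inl i)
      convert this using 1
      funext k
      refine propext ⟨False.elim, fun h => hno k (α.rel.symm' h)⟩
    have hβ : β.Compat (fun _ => False) (fun _ => False) := by
      rintro (a | a) (b | b) - <;> rfl
    have hc := (compat_mul α β _ _).2 ⟨_, hα, hβ⟩
    rw [hB'] at hj
    exact (hc _ _ hj).2 (α.rel.refl' _)
  · intro B hB B' hB' hg
    obtain ⟨i, hi, hgi⟩ := hmem B hB
    obtain ⟨i', hi', hgi'⟩ := hmem B' hB'
    rw [hgi, hgi'] at hg
    have h1 : α.rel (.inl i) (.inl i') := by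
      have : (Sum.inl i : Fin n ⊕ Fin n) ∈ {y | α.rel y (.inl i)} := α.rel.refl' _
      rw [hg] at this
      exact this
    have h2 : (α * β).rel (.inl i') (.inl i) := (α * β).rel.symm' (ker_le_ker_mul α β h1)
    have h3 : (Sum.inl i' : Fin n ⊕ Fin n) ∈ B := by
      rw [hcls B hB _ hi]; exact h2
    rw [hcls B hB _ h3, hcls B' hB' _ hi']

theorem rank_star_le (α : Partn n) : (star α).rank ≤ α.rank := by
  refine Set.ncard_le_ncard_of_injOn (fun B => Sum.swap ⁻¹' B) ?_ ?_ (Set.toFinite _)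
  · rintro B ⟨⟨z, rfl⟩, ⟨i, hi⟩, j, hj⟩
    refine ⟨⟨z.swap, ?_⟩, ⟨j, hj⟩, i, hi⟩
    ext y
    change α.rel y.swap.swap z.swap ↔ α.rel y z.swap
    rw [Sum.swap_swap]
  · intro B _ B' _ h
    exact Set.preimage_injective.2 (fun y => ⟨y.swap, by simp⟩) h

theorem rank_conj_le (ε α : Partn n) : (star α * ε * α).rank ≤ ε.rank := by
  have h := rank_star_le (star α * ε * α)
  calc (star α * ε * α).rank ≤ (star α * ε).rank := rank_mul_le _ _
    _ = (star (star ε * α)).rank := by rw [star_mul, star_star]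
    _ ≤ (star ε * α).rank := rank_star_le _
    _ ≤ (star ε).rank := rank_mul_le _ _
    _ ≤ ε.rank := rank_star_le _

/-! ### Auxiliary facts: closure under products and the involution -/

theorem isPartialBrauer_iff (α : Partn n) :
    α.IsPartialBrauer ↔ ∀ x y z, α.rel x y → α.rel x z → x = y ∨ x = z ∨ y = z := by
  constructor
  · intro h x y z hxy hxz
    by_contra hne
    push Not at hne
    have := h {w | α.rel w x} ⟨x, rfl⟩
    refine absurd this (not_le.2 ?_)
    rw [Set.two_lt_ncard_iff (Set.toFinite _)]
    exact ⟨x, y, z, α.rel.refl' x, α.rel.symm' hxy, α.rel.symm' hxz, hne.1, hne.2.1, hne.2.2⟩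
  · rintro h B ⟨w, rfl⟩
    by_contra hlt
    rw [not_le, Set.two_lt_ncard_iff (Set.toFinite _)] at hlt
    obtain ⟨x, y, z, hx, hy, hz, h1, h2, h3⟩ := hlt
    rcases h x y z (α.rel.trans' hx (α.rel.symm' hy)) (α.rel.trans' hx (α.rel.symm' hz))
      with e | e | e
    · exact h1 e
    · exact h2 e
    · exact h3 e

theorem boundaryPos_injective : Function.Injective (boundaryPos (n := n)) := by
  rintro (a | a) (b | b) h <;> simp only [boundaryPos, Sum.elim_inl, Sum.elim_inr] at h
  · exact congrArg _ (Fin.ext h)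
  · omega
  · omega
  · exact congrArg _ (Fin.ext (by omega))

theorem isPlanar_iff (α : Partn n) :
    α.IsPlanar ↔ ∀ a b c d, boundaryPos a < boundaryPos b → boundaryPos b < boundaryPos c →
      boundaryPos c < boundaryPos d → α.rel a c → α.rel b d → α.rel a b := by
  constructor
  · rintro ⟨G, hG, hcross⟩ a b c d hab hbc hcd hac hbd
    by_contra hne
    have key : ∀ u v, G.Adj u v → α.rel a u → ∀ x y, G.Adj x y → α.rel b x →
        ((boundaryPos u < boundaryPos x ∧ boundaryPos x < boundaryPos v) ↔
        (boundaryPos u < boundaryPos y ∧ boundaryPos y < boundaryPos v)) := by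
      intro u v huv hau x y hxy hbx
      have hav := α.rel.trans' hau ((hG _ _).1 huv.reachable)
      have hby := α.rel.trans' hbx ((hG _ _).1 hxy.reachable)
      have hdis : ∀ p q, α.rel a p → α.rel b q → boundaryPos p ≠ boundaryPos q := by
        intro p q hp hq h
        have := boundaryPos_injective h
        subst this
        exact hne (α.rel.trans' hp (α.rel.symm' hq))
      have d1 := hdis u x hau hbx
      have d2 := hdis u y hau hby
      have d3 := hdis v x hav hbx
      have d4 := hdis v y hav hby
      have c1 := hcross u x v y
      have c2 := hcross y u x v
      have c3 := hcross u y v x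
      have c4 := hcross x u y v
      have huv' := huv.symm
      have hxy' := hxy.symm
      constructor
      · rintro ⟨h1, h2⟩
        by_contra h3
        rcases lt_or_gt_of_ne d2 with h4 | h4
        · rcases lt_or_gt_of_ne d4 with h5 | h5
          · exact c1 h1 h2 h5 huv hxy
          · exact h3 ⟨h4, h5⟩
        · exact c2 h4 h1 h2 hxy' huv
      · rintro ⟨h1, h2⟩
        by_contra h3
        rcases lt_or_gt_of_ne d1 with h4 | h4
        · rcases lt_or_gt_of_ne d3 with h5 | h5
          · exact c3 h1 h2 h5 huv hxy'
          · exact h3 ⟨h4, h5⟩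
        · exact c4 h4 h1 h2 hxy huv
    have key2 : ∀ u v, G.Adj u v → α.rel a u →
        ((boundaryPos u < boundaryPos b ∧ boundaryPos b < boundaryPos v) ↔
        (boundaryPos u < boundaryPos d ∧ boundaryPos d < boundaryPos v)) := by
      intro u v huv hau
      obtain ⟨w⟩ := (hG b d).2 hbd
      have : ∀ x y, G.Walk x y → α.rel b x →
          ((boundaryPos u < boundaryPos x ∧ boundaryPos x < boundaryPos v) ↔
          (boundaryPos u < boundaryPos y ∧ boundaryPos y < boundaryPos v)) := by
        intro x y w
        induction w with
        | nil => intro _; rfl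
        | cons h w ih =>
          intro hb
          exact (key u v huv hau _ _ h hb).trans
            (ih (α.rel.trans' hb ((hG _ _).1 h.reachable)))
      exact this b d w (α.rel.refl' b)
    have hdis : ∀ p q, α.rel a p → α.rel b q → boundaryPos p ≠ boundaryPos q := by
      intro p q hp hq h
      have := boundaryPos_injective h
      subst this
      exact hne (α.rel.trans' hp (α.rel.symm' hq))
    have key3 : ∀ u v, G.Walk u v → α.rel a u →
        ((boundaryPos b < boundaryPos u ∧ boundaryPos u < boundaryPos d) ↔
        (boundaryPos b < boundaryPos v ∧ boundaryPos v < boundaryPos d)) := by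
      intro u v w
      induction w with
      | nil => intro _; rfl
      | @cons u v _ h w ih =>
        intro ha
        have hav := α.rel.trans' ha ((hG _ _).1 h.reachable)
        refine Iff.trans ?_ (ih hav)
        have e1 := key2 u v h ha
        have e2 := key2 v u h.symm hav
        have d1 := hdis u b ha (α.rel.refl' b)
        have d2 := hdis v b hav (α.rel.refl' b)
        have d3 := hdis u d ha hbd
        have d4 := hdis v d hav hbd
        omega
    obtain ⟨w⟩ := (hG a c).2 hac
    have := (key3 a c w (α.rel.refl' a)).2 ⟨hbc, hcd⟩
    omega
  · intro h
    let G : SimpleGraph (Fin n ⊕ Fin n) :=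
      { Adj := fun x y => x ≠ y ∧ α.rel x y ∧ ∀ z, α.rel x z →
          ¬ (boundaryPos x < boundaryPos z ∧ boundaryPos z < boundaryPos y) ∧
          ¬ (boundaryPos y < boundaryPos z ∧ boundaryPos z < boundaryPos x)
        symm := by
          refine ⟨?_⟩
          rintro x y ⟨h1, h2, h3⟩
          refine ⟨h1.symm, α.rel.symm' h2, fun z hz => ?_⟩
          have := h3 z (α.rel.trans' h2 hz)
          exact ⟨this.2, this.1⟩
        loopless := ⟨fun x hx => hx.1 rfl⟩ }
    refine ⟨G, fun x y => ⟨?_, ?_⟩, ?_⟩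
    · rintro ⟨w⟩
      induction w with
      | nil => exact α.rel.refl' _
      | cons hadj _ ih => exact α.rel.trans' hadj.2.1 ih
    · have main : ∀ k : ℕ, ∀ x y, boundaryPos y - boundaryPos x = k →
          boundaryPos x ≤ boundaryPos y → α.rel x y → G.Reachable x y := by
        intro k
        induction k using Nat.strong_induction_on with
        | _ k ih =>
          intro x y hk hle hxy
          by_cases hz : ∃ z, α.rel x z ∧ boundaryPos x < boundaryPos z ∧
              boundaryPos z < boundaryPos y
          · obtain ⟨z, hxz, h1, h2⟩ := hz
            exact (ih _ (by omega) x z rfl h1.le hxz).trans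
              (ih _ (by omega) z y rfl h2.le (α.rel.trans' (α.rel.symm' hxz) hxy))
          · by_cases hne : x = y
            · subst hne; exact SimpleGraph.Reachable.refl _
            · refine SimpleGraph.Adj.reachable ⟨hne, hxy, fun z hxz => ⟨?_, ?_⟩⟩
              · exact fun hh => hz ⟨z, hxz, hh⟩
              · omega
      intro hxy
      rcases le_total (boundaryPos x) (boundaryPos y) with hle | hle
      · exact main _ x y rfl hle hxy
      · exact (main _ y x rfl hle (α.rel.symm' hxy)).symm
    · intro a b c d hab hbc hcd hac hbd
      exact (hac.2.2 b (h a b c d hab hbc hcd hac.2.1 hbd.2.1)).1 ⟨hab, hbc⟩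

/-- The equivalence obtained by merging the classes of `p` and `q`. -/
def glue {X : Type*} (R : Setoid X) (p q : X) : Setoid X where
  r x y := R x y ∨ (R x p ∧ R q y) ∨ (R x q ∧ R p y)
  iseqv := by
    have hs : ∀ {x y}, R x y → R y x := R.symm'
    have ht : ∀ {x y z}, R x y → R y z → R x z := R.trans'
    refine ⟨fun x => Or.inl (R.refl' x), ?_, ?_⟩
    · rintro x y (h | ⟨h1, h2⟩ | ⟨h1, h2⟩)
      · exact Or.inl (hs h)
      · exact Or.inr (Or.inr ⟨hs h2, hs h1⟩)
      · exact Or.inr (Or.inl ⟨hs h2, hs h1⟩)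
    · rintro x y z (h | ⟨h1, h2⟩ | ⟨h1, h2⟩) (k | ⟨k1, k2⟩ | ⟨k1, k2⟩)
      · exact Or.inl (ht h k)
      · exact Or.inr (Or.inl ⟨ht h k1, k2⟩)
      · exact Or.inr (Or.inr ⟨ht h k1, k2⟩)
      · exact Or.inr (Or.inl ⟨h1, ht h2 k⟩)
      · exact Or.inr (Or.inl ⟨h1, k2⟩)
      · exact Or.inl (ht h1 k2)
      · exact Or.inr (Or.inr ⟨h1, ht h2 k⟩)
      · exact Or.inl (ht h1 k2)
      · exact Or.inr (Or.inr ⟨h1, k2⟩)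

theorem glue_iff {X : Type*} (R : Setoid X) (p q x y : X) :
    glue R p q x y ↔ R x y ∨ (R x p ∧ R q y) ∨ (R x q ∧ R p y) := Iff.rfl

/-- Two partitions side by side, with the first `k` pairs of middle vertices glued. -/
def glued (α β : Partn n) : ℕ → Setoid ((Fin n ⊕ Fin n) ⊕ (Fin n ⊕ Fin n))
  | 0 =>
    { r := fun x y => Sum.LiftRel α.rel β.rel x y
      iseqv := by
        refine ⟨?_, ?_, ?_⟩
        · rintro (x | x)
          · exact .inl (α.rel.refl' x)
          · exact .inr (β.rel.refl' x)
        · rintro _ _ (h | h)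
          · exact .inl (α.rel.symm' h)
          · exact .inr (β.rel.symm' h)
        · rintro _ _ _ (h | h) (k | k)
          · exact .inl (α.rel.trans' h k)
          · exact .inr (β.rel.trans' h k) }
  | k + 1 => if h : k < n then
      glue (glued α β k) (.inl (.inr ⟨k, h⟩)) (.inr (.inl ⟨k, h⟩)) else glued α β k

theorem glued_zero (α β : Partn n) (x y) :
    glued α β 0 x y ↔ Sum.LiftRel α.rel β.rel x y := Iff.rfl

theorem glued_succ (α β : Partn n) {k : ℕ} (h : k < n) :
    glued α β (k + 1) =
      glue (glued α β k) (.inl (.inr ⟨k, h⟩)) (.inr (.inl ⟨k, h⟩)) := by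
  rw [glued, dif_pos h]

theorem glued_mono (α β : Partn n) {j k : ℕ} (hjk : j ≤ k) : glued α β j ≤ glued α β k := by
  induction k, hjk using Nat.le_induction with
  | base => exact le_rfl
  | succ k _ ih =>
    refine ih.trans ?_
    by_cases h : k < n
    · rw [glued_succ α β h]
      exact fun {x y} hxy => Or.inl hxy
    · rw [glued, dif_neg h]

theorem glued_middle (α β : Partn n) (i : Fin n) :
    glued α β n (.inl (.inr i)) (.inr (.inl i)) := by
  refine glued_mono α β (Nat.succ_le_of_lt i.2) ?_
  rw [Nat.succ_eq_add_one, glued_succ α β i.2]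
  exact Or.inr (Or.inl ⟨Setoid.refl' _ _, Setoid.refl' _ _⟩)

/-- The inclusion of the outer vertices. -/
def outer (x : Fin n ⊕ Fin n) : (Fin n ⊕ Fin n) ⊕ (Fin n ⊕ Fin n) :=
  Sum.elim (fun i => .inl (.inl i)) (fun i => .inr (.inr i)) x

theorem outer_injective : Function.Injective (outer (n := n)) := by
  rintro (a | a) (b | b) h <;> simp_all [outer]

theorem mul_rel_iff (α β : Partn n) (x y : Fin n ⊕ Fin n) :
    (α * β).rel x y ↔ glued α β n (outer x) (outer y) := by
  have hs : ∀ {x y}, glued α β n x y → glued α β n y x := Setoid.symm' _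
  have ht : ∀ {x y z}, glued α β n x y → glued α β n y z → glued α β n x z := Setoid.trans' _
  constructor
  · intro h
    let o := outer x
    have h0 := glued_mono α β (Nat.zero_le n)
    have hc : (α * β).Compat (fun i => glued α β n o (.inl (.inl i)))
        (fun i => glued α β n o (.inr (.inr i))) := by
      rw [compat_mul]
      refine ⟨fun i => glued α β n o (.inl (.inr i)), fun a b hab => ?_, fun a b hab => ?_⟩
      · have hab' : glued α β n (.inl a) (.inl b) := h0 (Sum.LiftRel.inl hab)
        have : ∀ a, Sum.elim (fun i => glued α β n o (.inl (.inl i)))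
          (fun i => glued α β n o (.inl (.inr i))) a ↔ glued α β n o (.inl a) := by
          rintro (a | a) <;> rfl
        rw [this, this]
        exact ⟨fun h => ht h hab', fun h => ht h (hs hab')⟩
      · have hab' : glued α β n (.inr a) (.inr b) := h0 (Sum.LiftRel.inr hab)
        have : ∀ a, Sum.elim (fun i => glued α β n o (.inl (.inr i)))
          (fun i => glued α β n o (.inr (.inr i))) a ↔ glued α β n o (.inr a) := by
          rintro (a | a)
          · exact ⟨fun h => ht h (glued_middle α β a), fun h => ht h (hs (glued_middle α β a))⟩
          · rfl
        rw [this, this]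
        exact ⟨fun h => ht h hab', fun h => ht h (hs hab')⟩
    have h1 : ∀ a, Sum.elim (fun i => glued α β n o (.inl (.inl i)))
          (fun i => glued α β n o (.inr (.inr i))) a ↔ glued α β n o (outer a) := by
      rintro (a | a) <;> rfl
    have := hc x y h
    rw [h1, h1] at this
    exact this.1 (Setoid.refl' _ _)
  · intro h
    rw [rel_iff]
    intro u l hc
    obtain ⟨m, h1, h2⟩ := (compat_mul _ _ _ _).1 hc
    let F := Sum.elim (Sum.elim u m) (Sum.elim m l)
    have hF : ∀ k x y, glued α β k x y → (F x ↔ F y) := by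
      intro k
      induction k with
      | zero =>
        rintro _ _ (h | h)
        · exact h1 _ _ h
        · exact h2 _ _ h
      | succ k ih =>
        intro x y hxy
        by_cases hk : k < n
        · rw [glued_succ α β hk, glue_iff] at hxy
          rcases hxy with h | ⟨h, h'⟩ | ⟨h, h'⟩
          · exact ih _ _ h
          · have e := ih _ _ h'
            exact (ih _ _ h).trans e
          · have e := ih _ _ h'
            exact (ih _ _ h).trans e
        · rw [glued, dif_neg hk] at hxy
          exact ih _ _ hxy
    have := hF n _ _ h
    have ho : ∀ a, F (outer a) ↔ Sum.elim u l a := by rintro (a | a) <;> rfl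
    rwa [ho, ho] at this

/-- The vertices that remain once the first `k` pairs of middle vertices are removed. -/
def Remains (k : ℕ) (x : (Fin n ⊕ Fin n) ⊕ (Fin n ⊕ Fin n)) : Prop :=
  ∀ i : Fin n, (i : ℕ) < k → x ≠ .inl (.inr i) ∧ x ≠ .inr (.inl i)

theorem remains_outer (k : ℕ) (x : Fin n ⊕ Fin n) : Remains k (outer x) := by
  intro i _
  rcases x with x | x <;> simp [outer]

theorem remains_succ {k : ℕ} (hk : k < n) {x : (Fin n ⊕ Fin n) ⊕ (Fin n ⊕ Fin n)}
    (h : Remains (k + 1) x) :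
    Remains k x ∧ x ≠ .inl (.inr ⟨k, hk⟩) ∧ x ≠ .inr (.inl ⟨k, hk⟩) :=
  ⟨fun i hi => h i (by omega), h ⟨k, hk⟩ (by simp)⟩

theorem IsPartialBrauer.mul {α β : Partn n} (hα : α.IsPartialBrauer) (hβ : β.IsPartialBrauer) :
    (α * β).IsPartialBrauer := by
  rw [isPartialBrauer_iff] at hα hβ ⊢
  have main : ∀ k ≤ n, ∀ x y z, Remains k x → Remains k y → Remains k z →
      glued α β k x y → glued α β k x z → x = y ∨ x = z ∨ y = z := by
    intro k
    induction k with
    | zero =>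
      rintro - _ _ _ - - - (h | h) (h' | h')
      · simpa using hα _ _ _ h h'
      · simpa using hβ _ _ _ h h'
    | succ k ih =>
      intro hk x y z hx hy hz hxy hxz
      have hk' : k < n := hk
      have ih := ih hk'.le
      obtain ⟨hx, hxp, hxq⟩ := remains_succ hk' hx
      obtain ⟨hy, hyp, hyq⟩ := remains_succ hk' hy
      obtain ⟨hz, hzp, hzq⟩ := remains_succ hk' hz
      have hp : Remains k (.inl (.inr ⟨k, hk'⟩) : (Fin n ⊕ Fin n) ⊕ (Fin n ⊕ Fin n)) := by
        intro i hi
        refine ⟨?_, by simp⟩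
        intro h
        simp only [Sum.inl.injEq, Sum.inr.injEq] at h
        subst h
        simp at hi
      have hq : Remains k (.inr (.inl ⟨k, hk'⟩) : (Fin n ⊕ Fin n) ⊕ (Fin n ⊕ Fin n)) := by
        intro i hi
        refine ⟨by simp, ?_⟩
        intro h
        simp only [Sum.inl.injEq, Sum.inr.injEq] at h
        subst h
        simp at hi
      have hs : ∀ {x y}, glued α β k x y → glued α β k y x := Setoid.symm' _
      have hne : (.inl (.inr ⟨k, hk'⟩) : (Fin n ⊕ Fin n) ⊕ (Fin n ⊕ Fin n)) ≠
        .inr (.inl ⟨k, hk'⟩) := by simp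
      rw [glued_succ α β hk', glue_iff] at hxy hxz
      generalize (.inl (.inr ⟨k, hk'⟩) : (Fin n ⊕ Fin n) ⊕ (Fin n ⊕ Fin n)) = p at *
      generalize (.inr (.inl ⟨k, hk'⟩) : (Fin n ⊕ Fin n) ⊕ (Fin n ⊕ Fin n)) = q at *
      rcases hxy with h | ⟨h1, h2⟩ | ⟨h1, h2⟩ <;> rcases hxz with k | ⟨k1, k2⟩ | ⟨k1, k2⟩
      · exact ih x y z hx hy hz h k
      · have := ih x y p hx hy hp h k1; grind
      · have := ih x y q hx hy hq h k1; grind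
      · have := ih x z p hx hz hp k h1; grind
      · have := ih q y z hq hy hz h2 k2; grind
      · have := ih x p q hx hp hq h1 k1; grind
      · have := ih x z q hx hz hq k h1; grind
      · have := ih x p q hx hp hq k1 h1; grind
      · have := ih p y z hp hy hz h2 k2; grind
  intro x y z hxy hxz
  rw [mul_rel_iff] at hxy hxz
  have := main n le_rfl _ _ _ (remains_outer n x) (remains_outer n y) (remains_outer n z) hxy hxz
  simpa only [outer_injective.eq_iff] using this

/-- The positions along the boundary of the two rectangles, the second following the first. -/
def gluedPos (x : (Fin n ⊕ Fin n) ⊕ (Fin n ⊕ Fin n)) : ℕ :=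
  Sum.elim boundaryPos (fun v => 2 * n + boundaryPos v) x

theorem noncrossing_glue {X : Type*} (f : X → ℕ) (S S' : X → Prop) (R : Setoid X) (p q : X)
    (hR : ∀ a b c d, S a → S b → S c → S d → f a < f b → f b < f c → f c < f d →
      R a c → R b d → R a b)
    (hp : S p) (hq : S q)
    (hS : ∀ x, S' x → S x ∧ ((f x < f p ∧ f x < f q) ∨ (f p < f x ∧ f q < f x))) :
    ∀ a b c d, S' a → S' b → S' c → S' d → f a < f b → f b < f c → f c < f d →
      glue R p q a c → glue R p q b d → glue R p q a b := by
  have hs : ∀ {x y}, R x y → R y x := R.symm'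
  have ht : ∀ {x y z}, R x y → R y z → R x z := R.trans'
  -- a class meeting `p` and `q` on the two ends against an ordinary chord
  have one : ∀ p q, S p → S q →
      (∀ x, S' x → S x ∧ ((f x < f p ∧ f x < f q) ∨ (f p < f x ∧ f q < f x))) →
      ∀ a b c d, S' a → S' b → S' c → S' d → f a < f b → f b < f c → f c < f d →
      R a p → R q c → R b d → R a b ∨ R q b := by
    intro p q hp hq hS a b c d ha hb hc hd hab hbc hcd h1 h2 h3
    obtain ⟨ha, ha'⟩ := hS a ha
    obtain ⟨hb, hb'⟩ := hS b hb
    obtain ⟨hc, hc'⟩ := hS c hc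
    obtain ⟨hd, hd'⟩ := hS d hd
    rcases hb' with ⟨e1, e2⟩ | ⟨e1, e2⟩
    · rcases hd' with ⟨e3, e4⟩ | ⟨e3, e4⟩
      · exact Or.inr (ht h2 (hs (hR b c d q hb hc hd hq hbc hcd e4 h3 (hs h2))))
      · exact Or.inl (hR a b p d ha hb hp hd hab e1 e3 h1 h3)
    · exact Or.inr (hR q b c d hq hb hc hd e2 hbc hcd h2 h3)
  have two : ∀ p q, S p → S q →
      (∀ x, S' x → S x ∧ ((f x < f p ∧ f x < f q) ∨ (f p < f x ∧ f q < f x))) →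
      ∀ a b c d, S' a → S' b → S' c → S' d → f a < f b → f b < f c → f c < f d →
      R a c → R b p → R q d → R a b ∨ R a q := by
    intro p q hp hq hS a b c d ha hb hc hd hab hbc hcd h1 h2 h3
    obtain ⟨ha, ha'⟩ := hS a ha
    obtain ⟨hb, hb'⟩ := hS b hb
    obtain ⟨hc, hc'⟩ := hS c hc
    obtain ⟨hd, hd'⟩ := hS d hd
    rcases ha' with ⟨e1, e2⟩ | ⟨e1, e2⟩
    · rcases hc' with ⟨e3, e4⟩ | ⟨e3, e4⟩
      · exact Or.inl (hR a b c p ha hb hc hp hab hbc e3 h1 h2)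
      · exact Or.inr (hR a q c d ha hq hc hd e2 e4 hcd h1 h3)
    · exact Or.inl (ht (hs (hR p a b c hp ha hb hc e1 hab hbc (hs h2) h1)) (hs h2))
  have hS2 : ∀ x, S' x → S x ∧ ((f x < f q ∧ f x < f p) ∨ (f q < f x ∧ f p < f x)) :=
    fun x hx => ⟨(hS x hx).1, (hS x hx).2.imp And.symm And.symm⟩
  intro a b c d ha hb hc hd hab hbc hcd hac hbd
  simp only [glue_iff] at *
  rcases hac with h | ⟨h1, h2⟩ | ⟨h1, h2⟩ <;> rcases hbd with k | ⟨k1, k2⟩ | ⟨k1, k2⟩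
  · exact Or.inl (hR a b c d (hS a ha).1 (hS b hb).1 (hS c hc).1 (hS d hd).1 hab hbc hcd h k)
  · rcases two p q hp hq hS a b c d ha hb hc hd hab hbc hcd h k1 k2 with e | e
    · exact Or.inl e
    · exact Or.inr (Or.inr ⟨e, hs k1⟩)
  · rcases two q p hq hp hS2 a b c d ha hb hc hd hab hbc hcd h k1 k2 with e | e
    · exact Or.inl e
    · exact Or.inr (Or.inl ⟨e, hs k1⟩)
  · rcases one p q hp hq hS a b c d ha hb hc hd hab hbc hcd h1 h2 k with e | e
    · exact Or.inl e
    · exact Or.inr (Or.inl ⟨h1, e⟩)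
  · exact Or.inl (ht h1 (hs k1))
  · exact Or.inr (Or.inl ⟨h1, hs k1⟩)
  · rcases one q p hq hp hS2 a b c d ha hb hc hd hab hbc hcd h1 h2 k with e | e
    · exact Or.inl e
    · exact Or.inr (Or.inr ⟨h1, e⟩)
  · exact Or.inr (Or.inr ⟨h1, hs k1⟩)
  · exact Or.inl (ht h1 (hs k1))

theorem IsPlanar.mul {α β : Partn n} (hα : α.IsPlanar) (hβ : β.IsPlanar) :
    (α * β).IsPlanar := by
  rw [isPlanar_iff] at hα hβ ⊢
  have main : ∀ k ≤ n, ∀ a b c d, Remains k a → Remains k b → Remains k c → Remains k d →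
      gluedPos a < gluedPos b → gluedPos b < gluedPos c → gluedPos c < gluedPos d →
      glued α β k a c → glued α β k b d → glued α β k a b := by
    have hlt : ∀ v : Fin n ⊕ Fin n, boundaryPos v < 2 * n := by
      rintro (v | v) <;> simp only [boundaryPos, Sum.elim_inl, Sum.elim_inr] <;> omega
    intro k
    induction k with
    | zero =>
      rintro - (a | a) (b | b) (c | c) (d | d) - - - - h1 h2 h3 h4 h5
      all_goals simp only [glued_zero, Sum.liftRel_inl_inl, Sum.liftRel_inr_inr,
        Sum.not_liftRel_inl_inr, Sum.not_liftRel_inr_inl, gluedPos, Sum.elim_inl,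
        Sum.elim_inr] at *
      · exact hα a b c d h1 h2 h3 h4 h5
      · have := hlt c; omega
      · have := hlt b; omega
      · exact hβ a b c d (by omega) (by omega) (by omega) h4 h5
    | succ k ih =>
      intro hk
      have hk' : k < n := hk
      rw [glued_succ α β hk']
      refine noncrossing_glue gluedPos (Remains k) (Remains (k + 1)) _ _ _ (ih hk'.le) ?_ ?_ ?_
      · intro i hi
        refine ⟨?_, by simp⟩
        intro h
        simp only [Sum.inl.injEq, Sum.inr.injEq] at h
        subst h
        simp at hi
      · intro i hi
        refine ⟨by simp, ?_⟩
        intro h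
        simp only [Sum.inl.injEq, Sum.inr.injEq] at h
        subst h
        simp at hi
      · intro x hx
        refine ⟨(remains_succ hk' hx).1, ?_⟩
        rcases x with (x | x) | (x | x) <;>
          simp only [gluedPos, boundaryPos, Sum.elim_inl, Sum.elim_inr]
        · omega
        · have : ¬ (x : ℕ) < k + 1 := fun h => (hx x h).1 rfl
          omega
        · have : ¬ (x : ℕ) < k + 1 := fun h => (hx x h).2 rfl
          omega
        · omega
  intro a b c d hab hbc hcd hac hbd
  rw [mul_rel_iff] at hac hbd ⊢
  have hpos : ∀ x y : Fin n ⊕ Fin n, boundaryPos x < boundaryPos y →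
      gluedPos (outer x) < gluedPos (outer y) := by
    rintro (x | x) (y | y) h <;>
      simp only [gluedPos, outer, boundaryPos, Sum.elim_inl, Sum.elim_inr] at * <;> omega
  exact main n le_rfl _ _ _ _ (remains_outer n a) (remains_outer n b) (remains_outer n c)
    (remains_outer n d) (hpos _ _ hab) (hpos _ _ hbc) (hpos _ _ hcd) hac hbd

theorem isPartialBrauer_one : (1 : Partn n).IsPartialBrauer := by
  rw [isPartialBrauer_iff]
  intro x y z hxy hxz
  change (Sum.elim id id x : Fin n) = Sum.elim id id y at hxy
  change (Sum.elim id id x : Fin n) = Sum.elim id id z at hxz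
  rcases x with x | x <;> rcases y with y | y <;> rcases z with z | z <;> simp_all

theorem isPlanar_one : (1 : Partn n).IsPlanar := by
  rw [isPlanar_iff]
  intro a b c d hab hbc hcd hac hbd
  change (Sum.elim id id a : Fin n) = Sum.elim id id c at hac
  change (Sum.elim id id b : Fin n) = Sum.elim id id d at hbd
  rcases a with a | a <;> rcases b with b | b <;> rcases c with c | c <;> rcases d with d | d <;>
    simp only [boundaryPos, Sum.elim_inl, Sum.elim_inr, id, Fin.ext_iff] at * <;> omega

theorem IsPartialBrauer.star {α : Partn n} (hα : α.IsPartialBrauer) :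
    (star α).IsPartialBrauer := by
  rw [isPartialBrauer_iff] at hα ⊢
  intro x y z hxy hxz
  have hinj : Function.Injective (Sum.swap : Fin n ⊕ Fin n → Fin n ⊕ Fin n) :=
    Function.LeftInverse.injective Sum.swap_swap
  simpa only [hinj.eq_iff] using hα x.swap y.swap z.swap hxy hxz

theorem IsPlanar.star {α : Partn n} (hα : α.IsPlanar) : (star α).IsPlanar := by
  rw [isPlanar_iff] at hα ⊢
  intro a b c d hab hbc hcd hac hbd
  have hpos : ∀ x y : Fin n ⊕ Fin n, boundaryPos x < boundaryPos y →
      boundaryPos y.swap < boundaryPos x.swap := by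
    rintro (x | x) (y | y) h <;>
      simp only [boundaryPos, Sum.swap_inl, Sum.swap_inr, Sum.elim_inl, Sum.elim_inr] at * <;>
      omega
  have hac' : α.rel a.swap c.swap := hac
  have hbd' : α.rel b.swap d.swap := hbd
  have h := hα _ _ _ _ (hpos _ _ hcd) (hpos _ _ hbc) (hpos _ _ hab)
    (α.rel.symm' hbd') (α.rel.symm' hac')
  exact α.rel.trans' hac' (α.rel.trans' (α.rel.symm' h) (α.rel.symm' hbd'))

end Partn

/-! ### The diagram monoids and the action on projections -/

/-- A submonoid of the partition monoid that is closed under the involution. -/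
structure StarSubmonoid (n : ℕ) extends Submonoid (Partn n) where
  star_mem' : ∀ a ∈ carrier, star a ∈ carrier

/-- The partition monoid. -/
def partitionMonoid (n : ℕ) : StarSubmonoid n where
  toSubmonoid := ⊤
  star_mem' _ _ := trivial

/-- The partial Brauer monoid. -/
def partialBrauerMonoid (n : ℕ) : StarSubmonoid n where
  carrier := {α | α.IsPartialBrauer}
  mul_mem' := fun ha hb => ha.mul hb
  one_mem' := Partn.isPartialBrauer_one
  star_mem' _ ha := ha.star

/-- The planar partition monoid. -/
def planarPartitionMonoid (n : ℕ) : StarSubmonoid n where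
  carrier := {α | α.IsPlanar}
  mul_mem' := fun ha hb => ha.mul hb
  one_mem' := Partn.isPlanar_one
  star_mem' _ ha := ha.star

/-- The Motzkin monoid. -/
def motzkinMonoid (n : ℕ) : StarSubmonoid n where
  carrier := {α | α.IsPlanar ∧ α.IsPartialBrauer}
  mul_mem' := fun ha hb => ⟨ha.1.mul hb.1, ha.2.mul hb.2⟩
  one_mem' := ⟨Partn.isPlanar_one, Partn.isPartialBrauer_one⟩
  star_mem' _ ha := ⟨ha.1.star, ha.2.star⟩

namespace StarSubmonoid

variable {n : ℕ}

/-- The projections of `M` of rank at most two. -/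
def lowProjections (M : StarSubmonoid n) : Set (Partn n) :=
  {ε | ε ∈ M.toSubmonoid ∧ ε * ε = ε ∧ star ε = ε ∧ ε.rank ≤ 2}

theorem conj_mem (M : StarSubmonoid n) {ε α : Partn n} (hε : ε ∈ M.lowProjections)
    (hα : α ∈ M.toSubmonoid) : star α * ε * α ∈ M.lowProjections := by
  obtain ⟨h1, h2, h3, h4⟩ := hε
  have hconj : star α * ε * α = star (ε * α) * (ε * α) := by
    rw [star_mul, h3]
    simp only [mul_assoc]
    rw [← mul_assoc ε ε α, h2]
  refine ⟨mul_mem (mul_mem (M.star_mem' α hα) h1) hα, ?_, ?_,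
    (Partn.rank_conj_le ε α).trans h4⟩
  · have h5 := Partn.mul_star_mul (ε * α)
    rw [hconj]
    calc star (ε * α) * (ε * α) * (star (ε * α) * (ε * α))
        = star (ε * α) * (ε * α * star (ε * α) * (ε * α)) := by simp only [mul_assoc]
      _ = _ := by rw [h5]
  · rw [hconj, star_mul, star_star]

/-- The condition under which an element `α` sends a projection `ε` to a projection. -/
theorem ker_condition {ε α β : Partn n} (h2 : ε * ε = ε) (h3 : star ε = ε) :
    ε.ker = (ε * (α * β)).ker ↔
      ε.ker = (ε * α).ker ∧ (star α * ε * α).ker = (star α * ε * α * β).ker := by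
  have hle1 : ε.ker ≤ (ε * α).ker := Partn.ker_le_ker_mul _ _
  have hle2 : (ε * α).ker ≤ (ε * (α * β)).ker := by
    rw [← mul_assoc]; exact Partn.ker_le_ker_mul _ _
  have hpa : ε * α * (star α * ε * α) = ε * α := by
    have h5 := Partn.mul_star_mul (ε * α)
    rw [star_mul, h3] at h5
    calc ε * α * (star α * ε * α) = ε * α * (star α * ε) * α := by simp only [mul_assoc]
      _ = ε * α * (star α * ε) * (ε * α) := by
        simp only [mul_assoc]; rw [← mul_assoc ε ε α, h2]
      _ = ε * α := h5
  constructor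
  · intro h
    have e1 : ε.ker = (ε * α).ker := le_antisymm hle1 (h ▸ hle2)
    refine ⟨e1, le_antisymm (Partn.ker_le_ker_mul _ _) ?_⟩
    have : (ε * (α * β)).ker ≤ (ε * α).ker := by rw [← h, e1]
    have h6 := Partn.ker_mul_le (star α) this
    simpa only [mul_assoc] using h6
  · rintro ⟨e1, e2⟩
    refine le_antisymm (hle1.trans hle2) ?_
    have h6 := Partn.ker_mul_le (ε * α) e2.ge
    have h7 : ε * α * (star α * ε * α * β) = ε * (α * β) := by
      rw [← mul_assoc (ε * α), hpa, mul_assoc]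
    rw [hpa, h7, ← e1] at h6
    exact h6

open Classical in
/-- The action `μ` of `M` on `Q ∪ {-}`, where `Q` is the set of projections of `M` of rank at most
two and `none` is the symbol `-`: here `ε` is sent by `α` to `α* ε α` if `ker ε = ker (ε α)`,
and to `-` otherwise, and `-` is fixed. -/
noncomputable def projectionAction (M : StarSubmonoid n) :
    RightAction (Option M.lowProjections) M.toSubmonoid where
  act x α := match x with
    | none => none
    | some ε =>
      if (ε : Partn n).ker = ((ε : Partn n) * (α : Partn n)).ker then
        some ⟨star (α : Partn n) * ε * α, M.conj_mem ε.2 α.2⟩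
      else none
  act_mul := by
    rintro (_ | ε) α β
    · rfl
    · have hk := ker_condition (α := (α : Partn n)) (β := (β : Partn n)) ε.2.2.1 ε.2.2.2.1
      by_cases h1 : (ε : Partn n).ker = ((ε : Partn n) * (α : Partn n)).ker
      · simp only [if_pos h1, Submonoid.coe_mul]
        by_cases h2 : (star (α : Partn n) * ε * α).ker = (star (α : Partn n) * ε * α * β).ker
        · rw [if_pos h2, if_pos (hk.2 ⟨h1, h2⟩)]
          simp only [star_mul, mul_assoc]
        · rw [if_neg h2, if_neg fun h => h2 (hk.1 h).2]
      · simp only [if_neg h1, Submonoid.coe_mul]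
        rw [if_neg fun h => h1 (hk.1 h).1]

end StarSubmonoid

end Diag

/-!
Everything rests on the Boolean description `Partn.Compat` of a partition: products become
composition of relations between subsets of `Fin n`, and the involution becomes the converse.
The only fact needed about `M` is that it contains the Motzkin monoid.

*Faithfulness.* The partial identity on a set `S` of at most two points is a projection of `M` of
rank at most two. It is sent to `-` by `α` exactly when two points of `S` lie in the same block
of `α`, so the pairs `S = {i, j}` recover `ker α`. The image of the partial identity on `{i}`
contains the block of `j`, `j'` exactly when `i` and `j'` lie in the same block of `α`, and the
image of the empty partial identity has the lower kernel of `α` as its kernel. Hence the action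
determines `α`.

*Monogenicity.* The partial identity on `{0, 1}` generates. An element with upper block `{0, 1}`
sends it to `-`. If `η` is a projection of rank at most two, let `T` be the set of the least
points of its transversals, so that `T` has at most two elements, and let `γ` be the
order-preserving partial bijection from an initial segment of `{0, 1}` onto `T`. Then `γ` is a
Motzkin element, and `γ * η` sends the partial identity on `{0, 1}` to `η`
(`conj_minTransversalMap`).

*Degrees.* Every point is of the form `x α` for the generator `x`, so `μ` is isomorphic to the
action on the classes of the right congruence `x α = x β`, and `μ` itself bounds `degRC`. Any
faithful action on `m` points is an embedding in the transformation monoid, so `deg ≤ degRC`.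
-/

namespace Diag

/-! ### Degrees and monogenic actions -/

theorem deg_le_degRC (S : Type*) [Semigroup S] : deg S ≤ degRC S := by
  refine le_iInf₂ fun m hm => ?_
  obtain ⟨hm1, X, μ, hX, hf, -⟩ := hm
  have : Finite X := Nat.finite_of_card_ne_zero (by omega)
  let e : X ≃ Fin m := Finite.equivFinOfCardEq hX
  refine iInf₂_le m ⟨hm1, ⟨fun a => MulOpposite.op fun k => e (μ.act (e.symm k) a), ?_⟩, ?_⟩
  · intro a b
    apply MulOpposite.unop_injective
    funext k
    change e (μ.act (e.symm k) (a * b)) = e (μ.act (e.symm (e (μ.act (e.symm k) a))) b)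
    rw [e.symm_apply_apply, μ.act_mul]
  · intro a b hab
    refine hf (funext fun x => ?_)
    have h := congrFun (MulOpposite.op_injective hab) (e x)
    simpa using h

/-- The congruence is the one identifying `a` and `b` when they agree on the generator `x`. -/
theorem RightAction.isRightCongruenceAction_of_surjective {X S : Type*} [Semigroup S]
    (μ : RightAction X S) (x : X) (hx : Function.Surjective (μ.act x)) :
    μ.IsRightCongruenceAction := by
  have hσ : IsRightCongruence (Setoid.ker (μ.act x)) := by
    intro a b s h
    change μ.act x (a * s) = μ.act x (b * s)
    rw [← μ.act_mul, ← μ.act_mul, show μ.act x a = μ.act x b from h]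
  refine ⟨_, hσ, (Setoid.quotientKerEquivOfSurjective _ hx).symm, ?_⟩
  intro y a
  obtain ⟨b, rfl⟩ := hx y
  rw [Equiv.symm_apply_eq]
  have h1 : (Setoid.quotientKerEquivOfSurjective _ hx).symm (μ.act x b) = Quotient.mk _ b := by
    rw [Equiv.symm_apply_eq]
    rfl
  rw [h1, μ.act_mul]
  rfl

namespace Partn

variable {n : ℕ}

instance : Finite (Partn n) :=
  Finite.of_injective (fun α : Partn n => fun x y => α.rel x y) fun α β h =>
    Partn.ext (Setoid.ext fun x y => by rw [show α.rel x y = β.rel x y from congrFun₂ h x y])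

/-! ### Partial bijections and upper hooks as partitions -/

/-- The partition whose nontrivial blocks are the pairs `{i, j'}` with `g j = some i`. The partial
map `g` thus goes from the lower row to the upper row; it is meant to be injective where it is
defined. -/
def ofPartialMap (g : Fin n → Option (Fin n)) : Partn n :=
  ⟨Setoid.ker (Sum.elim Sum.inl fun j => (g j).elim (Sum.inr j) Sum.inl)⟩

theorem ofPartialMap_rel (g : Fin n → Option (Fin n)) (x y : Fin n ⊕ Fin n) :
    (ofPartialMap g).rel x y ↔
      (Sum.elim Sum.inl (fun j => (g j).elim (Sum.inr j) Sum.inl) x : Fin n ⊕ Fin n) =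
        Sum.elim Sum.inl (fun j => (g j).elim (Sum.inr j) Sum.inl) y := Iff.rfl

theorem compat_ofPartialMap (g : Fin n → Option (Fin n)) (u l : Fin n → Prop) :
    (ofPartialMap g).Compat u l ↔ ∀ i j, g j = some i → (u i ↔ l j) := by
  constructor
  · intro h i j hij
    exact h (.inl i) (.inr j) (by simp [ofPartialMap_rel, hij])
  · intro h a b hab
    -- both sides are read off at the common value of the map defining the blocks
    have key : ∀ a, Sum.elim u l a ↔ Sum.elim u l
        (Sum.elim Sum.inl (fun j => (g j).elim (Sum.inr j) Sum.inl) a) := by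
      rintro (a | a)
      · rfl
      · cases hg : g a with
        | none => simp [hg]
        | some i => simpa [hg] using (h i a hg).symm
    rw [key a, key b, (ofPartialMap_rel g a b).1 hab]

theorem ker_ofPartialMap (g : Fin n → Option (Fin n)) : (ofPartialMap g).ker = ⊥ := by
  ext x y
  change (Sum.inl x : Fin n ⊕ Fin n) = Sum.inl y ↔ x = y
  simp

theorem ofPartialMap_rel_inl_inr (g : Fin n → Option (Fin n)) (i j : Fin n) :
    (ofPartialMap g).rel (.inl i) (.inr j) ↔ g j = some i := by
  rw [ofPartialMap_rel]
  cases hg : g j with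
  | none => simp [hg]
  | some k => simp [hg, eq_comm]

theorem ofPartialMap_rel_inr_inr {g : Fin n → Option (Fin n)}
    (hg : ∀ i j j', g j = some i → g j' = some i → j = j') (j j' : Fin n) :
    (ofPartialMap g).rel (.inr j) (.inr j') ↔ j = j' := by
  refine ⟨fun h => ?_, fun h => h ▸ Setoid.refl' _ _⟩
  rw [ofPartialMap_rel] at h
  cases h1 : g j with
  | none => cases h2 : g j' with
    | none => simpa [h1, h2] using h
    | some k => simp [h1, h2] at h
  | some i => cases h2 : g j' with
    | none => simp [h1, h2] at h
    | some k =>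
      simp only [Sum.elim_inr, h1, h2, Option.elim_some, Sum.inl.injEq] at h
      exact hg i j j' h1 (h ▸ h2)

theorem ofPartialMap_motzkin {g : Fin n → Option (Fin n)}
    (hg : ∀ i j i' j', g j = some i → g j' = some i' → j < j' → i < i') :
    (ofPartialMap g).IsPlanar ∧ (ofPartialMap g).IsPartialBrauer := by
  have hinj : ∀ i j j', g j = some i → g j' = some i → j = j' := by
    intro i j j' h1 h2
    rcases lt_trichotomy j j' with h | h | h
    · exact absurd (hg _ _ _ _ h1 h2 h) (lt_irrefl _)
    · exact h
    · exact absurd (hg _ _ _ _ h2 h1 h) (lt_irrefl _)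
  have hll : ∀ i j : Fin n, (ofPartialMap g).rel (.inl i) (.inl j) ↔ i = j := by
    intro i j
    change (Sum.inl i : Fin n ⊕ Fin n) = Sum.inl j ↔ i = j
    simp
  have hlr := ofPartialMap_rel_inl_inr g
  have hrl : ∀ j i, (ofPartialMap g).rel (.inr j) (.inl i) ↔ g j = some i := fun j i =>
    ⟨fun h => (hlr i j).1 (Setoid.symm' _ h), fun h => Setoid.symm' _ ((hlr i j).2 h)⟩
  have hrr := ofPartialMap_rel_inr_inr hinj
  constructor
  · rw [isPlanar_iff]
    rintro (a | a) (b | b) (c | c) (d | d) hab hbc hcd hac hbd <;>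
      simp only [hll, hlr, hrl, hrr, boundaryPos, Sum.elim_inl, Sum.elim_inr] at * <;>
      first
        | omega
        | (have := hg _ _ _ _ hbd hac (by rw [Fin.lt_def]; omega)
           rw [Fin.lt_def] at this; omega)
  · rw [isPartialBrauer_iff]
    rintro (x | x) (y | y) (z | z) hxy hxz <;>
      simp only [hll, hlr, hrl, hrr, Sum.inl.injEq, Sum.inr.injEq] at * <;> grind

/-- The partition whose only nontrivial block is the pair of upper vertices `{a, b}`. -/
def upperHook (a b : Fin n) : Partn n :=
  ⟨Setoid.ker (Function.update id (Sum.inl b) (Sum.inl a))⟩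

theorem upperHook_rel (a b : Fin n) (x y : Fin n ⊕ Fin n) :
    (upperHook a b).rel x y ↔ Function.update id (Sum.inl b) (Sum.inl a) x =
      Function.update id (Sum.inl b) (Sum.inl a) y := Iff.rfl

theorem upperHook_motzkin {a b : Fin n} (hab : (b : ℕ) = a + 1) :
    (upperHook a b).IsPlanar ∧ (upperHook a b).IsPartialBrauer := by
  have key : ∀ x y, (upperHook a b).rel x y →
      x = y ∨ (x = .inl a ∧ y = .inl b) ∨ (x = .inl b ∧ y = .inl a) := by
    intro x y h
    rw [upperHook_rel] at h
    simp only [Function.update_apply, id] at h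
    grind
  constructor
  · rw [isPlanar_iff]
    intro x y z w hxy hyz hzw hxz _
    rcases key _ _ hxz with rfl | ⟨rfl, rfl⟩ | ⟨rfl, rfl⟩ <;>
      simp only [boundaryPos, Sum.elim_inl] at hxy hyz <;> omega
  · rw [isPartialBrauer_iff]
    intro x y z hxy hxz
    have h1 := key _ _ hxy
    have h2 := key _ _ hxz
    grind

theorem upperHook_ker (a b : Fin n) : (upperHook a b).ker a b := by
  change Function.update id (Sum.inl b) (Sum.inl a) (Sum.inl a : Fin n ⊕ Fin n) =
      Function.update id (Sum.inl b) (Sum.inl a) (Sum.inl b)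
  simp only [Function.update_apply, id]
  grind

/-! ### Partial identities -/

/-- The partition with the blocks `{i, i'}` for `i ∈ S`, and all other blocks trivial. -/
def partialIdentity (S : Finset (Fin n)) : Partn n :=
  ofPartialMap fun j => if j ∈ S then some j else none

theorem compat_partialIdentity (S : Finset (Fin n)) (u l : Fin n → Prop) :
    (partialIdentity S).Compat u l ↔ ∀ i ∈ S, (u i ↔ l i) := by
  rw [partialIdentity, compat_ofPartialMap]
  constructor
  · intro h i hi
    exact h i i (by simp [hi])
  · intro h i j hij
    simp only [Option.ite_none_right_eq_some, Option.some.injEq] at hij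
    obtain ⟨hj, rfl⟩ := hij
    exact h _ hj

theorem partialIdentity_motzkin (S : Finset (Fin n)) :
    (partialIdentity S).IsPlanar ∧ (partialIdentity S).IsPartialBrauer := by
  refine ofPartialMap_motzkin fun i j i' j' h h' hlt => ?_
  simp only [Option.ite_none_right_eq_some, Option.some.injEq] at h h'
  rwa [← h.2, ← h'.2]

theorem partialIdentity_mul_self (S : Finset (Fin n)) :
    partialIdentity S * partialIdentity S = partialIdentity S := by
  apply ext_compat
  intro u l
  simp only [compat_mul, compat_partialIdentity]
  exact ⟨fun ⟨m, h1, h2⟩ i hi => (h1 i hi).trans (h2 i hi), fun h => ⟨u, fun _ _ => Iff.rfl, h⟩⟩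

theorem star_partialIdentity (S : Finset (Fin n)) :
    star (partialIdentity S) = partialIdentity S := by
  apply ext_compat
  intro u l
  simp only [compat_star, compat_partialIdentity]
  exact forall₂_congr fun _ _ => Iff.comm

theorem rank_partialIdentity_le (S : Finset (Fin n)) : (partialIdentity S).rank ≤ S.card := by
  have hsub : (partialIdentity S).transversals ⊆
      (fun i => {y | (partialIdentity S).rel y (.inl i)}) '' (S : Set (Fin n)) := by
    rintro _ ⟨⟨z, rfl⟩, ⟨i, hi⟩, j, hj⟩
    have hij : (partialIdentity S).rel (.inl i) (.inr j) :=
      Setoid.trans' _ hi (Setoid.symm' _ hj)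
    rw [partialIdentity, ofPartialMap_rel_inl_inr, Option.ite_none_right_eq_some] at hij
    obtain ⟨hS, h⟩ := hij
    obtain rfl : j = i := Option.some.inj h
    refine ⟨j, hS, ?_⟩
    ext y
    exact ⟨fun h => (partialIdentity S).rel.trans' h hi,
      fun h => (partialIdentity S).rel.trans' h ((partialIdentity S).rel.symm' hi)⟩
  calc (partialIdentity S).rank ≤ _ := Set.ncard_le_ncard hsub (Set.toFinite _)
    _ ≤ (S : Set (Fin n)).ncard := Set.ncard_image_le (Set.toFinite _)
    _ = S.card := Set.ncard_coe_finset S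

theorem ker_partialIdentity_mul_iff (S : Finset (Fin n)) (α : Partn n) :
    (partialIdentity S).ker = (partialIdentity S * α).ker ↔
      ∀ x ∈ S, ∀ y ∈ S, α.ker x y → x = y := by
  constructor
  · intro h x hx y hy hxy
    have h1 : (partialIdentity S * α).ker x y := by
      change (partialIdentity S * α).rel (.inl x) (.inl y)
      rw [rel_iff]
      intro u l hc
      obtain ⟨m, h1, h2⟩ := (compat_mul _ _ _ _).1 hc
      rw [compat_partialIdentity] at h1
      exact (h1 x hx).trans ((h2 (.inl x) (.inl y) hxy).trans (h1 y hy).symm)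
    rw [← h, partialIdentity, ker_ofPartialMap] at h1
    exact h1
  · intro h
    refine le_antisymm (ker_le_ker_mul _ _) ?_
    rw [ker_le_iff]
    rintro u -
    obtain ⟨l, hl⟩ := (exists_compat_iff α fun x => ∃ y ∈ S, α.ker x y ∧ u y).2 (by
      intro x y hxy
      exact ⟨fun ⟨z, hz, h1, h2⟩ => ⟨z, hz, α.ker.trans' (α.ker.symm' hxy) h1, h2⟩,
        fun ⟨z, hz, h1, h2⟩ => ⟨z, hz, α.ker.trans' hxy h1, h2⟩⟩)
    refine ⟨l, (compat_mul _ _ _ _).2 ⟨_, ?_, hl⟩⟩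
    rw [compat_partialIdentity]
    intro i hi
    exact ⟨fun hu => ⟨i, hi, α.ker.refl' i, hu⟩,
      fun ⟨y, hy, h1, h2⟩ => (h i hi y hy h1) ▸ h2⟩

theorem compat_conj_partialIdentity (S : Finset (Fin n)) (α : Partn n) (u l : Fin n → Prop) :
    (star α * partialIdentity S * α).Compat u l ↔
      ∃ m m', α.Compat m u ∧ α.Compat m' l ∧ ∀ i ∈ S, (m i ↔ m' i) := by
  simp only [compat_mul, compat_star, compat_partialIdentity]
  exact ⟨fun ⟨m', ⟨m, h1, h2⟩, h3⟩ => ⟨m, m', h1, h3, h2⟩,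
    fun ⟨m, m', h1, h3, h2⟩ => ⟨m', ⟨m, h1, h2⟩, h3⟩⟩

theorem compat_false (α : Partn n) : α.Compat (fun _ => False) (fun _ => False) := by
  rintro (a | a) (b | b) - <;> rfl

theorem conj_partialIdentity_singleton_rel (α : Partn n) (i j : Fin n) :
    (star α * partialIdentity {i} * α).rel (.inl j) (.inr j) ↔ α.rel (.inl i) (.inr j) := by
  constructor
  · intro h
    by_contra hne
    have hc : (star α * partialIdentity {i} * α).Compat (fun k => α.rel (.inr j) (.inr k))
        (fun _ => False) := by
      refine (compat_conj_partialIdentity _ _ _ _).2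
        ⟨_, _, α.compat_class (.inr j), α.compat_false, ?_⟩
      intro k hk
      rw [Finset.mem_singleton.1 hk]
      exact ⟨fun h => hne (α.rel.symm' h), False.elim⟩
    exact (hc _ _ h).1 (α.rel.refl' _)
  · intro h
    rw [rel_iff]
    intro u l hc
    obtain ⟨m, m', h1, h2, h3⟩ := (compat_conj_partialIdentity _ _ _ _).1 hc
    exact (h1 _ _ h).symm.trans ((h3 i (Finset.mem_singleton_self i)).trans (h2 _ _ h))

theorem conj_partialIdentity_empty_rel (α : Partn n) (j k : Fin n) :
    (star α * partialIdentity ∅ * α).rel (.inl j) (.inl k) ↔ α.rel (.inr j) (.inr k) := by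
  constructor
  · intro h
    have hc : (star α * partialIdentity ∅ * α).Compat (fun k => α.rel (.inr j) (.inr k))
        (fun _ => False) :=
      (compat_conj_partialIdentity _ _ _ _).2
        ⟨_, _, α.compat_class (.inr j), α.compat_false, by simp⟩
    exact (hc _ _ h).1 (α.rel.refl' _)
  · intro h
    rw [rel_iff]
    intro u l hc
    obtain ⟨m, m', h1, h2, h3⟩ := (compat_conj_partialIdentity _ _ _ _).1 hc
    exact h1 _ _ h

/-! ### Projections and their transversals -/

/-- The transversals of a projection are symmetric under the involution. -/
theorem rel_inl_inr_self {η : Partn n} (h2 : η * η = η) (h3 : star η = η) {i j : Fin n}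
    (hij : η.rel (.inl i) (.inr j)) : η.rel (.inl i) (.inr i) := by
  have hji : η.rel (.inl j) (.inr i) := by
    have h : (star η).rel (.inl j) (.inr i) := η.rel.symm' hij
    rwa [h3] at h
  rw [rel_iff]
  intro u l hc
  rw [← h2, compat_mul] at hc
  obtain ⟨m, h1, h2⟩ := hc
  exact (h1 _ _ hij).trans (h2 _ _ hji)

open Classical in
/-- The least upper vertices of the blocks of `η` that contain some pair `i`, `i'`. If `η` is a
projection, these blocks are its transversals. -/
noncomputable def minTransversal (η : Partn n) : Finset (Fin n) :=
  {k | η.rel (.inl k) (.inr k) ∧ ∀ i < k, ¬ η.ker i k}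

theorem mem_minTransversal {η : Partn n} {k : Fin n} :
    k ∈ η.minTransversal ↔ η.rel (.inl k) (.inr k) ∧ ∀ i < k, ¬ η.ker i k := by
  simp [minTransversal]

theorem eq_of_mem_minTransversal {η : Partn n} {k k' : Fin n} (hk : k ∈ η.minTransversal)
    (hk' : k' ∈ η.minTransversal) (h : η.ker k k') : k = k' := by
  rw [mem_minTransversal] at hk hk'
  rcases lt_trichotomy k k' with hlt | hlt | hlt
  · exact absurd h (hk'.2 _ hlt)
  · exact hlt
  · exact absurd (η.ker.symm' h) (hk.2 _ hlt)

theorem card_minTransversal_le (η : Partn n) : η.minTransversal.card ≤ η.rank := by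
  rw [← Set.ncard_coe_finset]
  refine Set.ncard_le_ncard_of_injOn (fun k => {y | η.rel y (.inl k)}) ?_ ?_ (Set.toFinite _)
  · intro k hk
    have hk := (mem_minTransversal.1 hk).1
    exact ⟨⟨_, rfl⟩, ⟨k, η.rel.refl' _⟩, k, η.rel.symm' hk⟩
  · intro k hk k' hk' h
    refine eq_of_mem_minTransversal hk hk' ?_
    have : (Sum.inl k : Fin n ⊕ Fin n) ∈ {y | η.rel y (.inl k)} := η.rel.refl' _
    rw [show {y | η.rel y (.inl k)} = {y | η.rel y (.inl k')} from h] at this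
    exact this

theorem exists_mem_minTransversal {η : Partn n} (h2 : η * η = η) (h3 : star η = η)
    {i j : Fin n} (hij : η.rel (.inl i) (.inr j)) : ∃ k ∈ η.minTransversal, η.ker i k := by
  induction i using WellFoundedLT.induction with
  | ind i ih =>
    by_cases h : ∃ k < i, η.ker k i
    · obtain ⟨k, hk, hki⟩ := h
      obtain ⟨k', hk', h'⟩ := ih k hk (η.rel.trans' hki hij)
      exact ⟨k', hk', η.ker.trans' (η.ker.symm' hki) h'⟩
    · push Not at h
      exact ⟨i, mem_minTransversal.2 ⟨rel_inl_inr_self h2 h3 hij, h⟩, η.ker.refl' i⟩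

open Classical in
/-- The order-preserving partial bijection from an initial segment of the upper row onto the set
`η.minTransversal` of lower vertices: each such vertex is joined to its index in the set. -/
noncomputable def minTransversalMap (η : Partn n) : Partn n :=
  ofPartialMap fun j => if j ∈ η.minTransversal then
    some ⟨(η.minTransversal.filter (· < j)).card,
      (Finset.card_lt_univ_of_notMem (x := j) (by simp)).trans_eq (Fintype.card_fin n)⟩ else none

theorem minTransversalMap_motzkin (η : Partn n) :
    η.minTransversalMap.IsPlanar ∧ η.minTransversalMap.IsPartialBrauer := by
  refine ofPartialMap_motzkin fun i j i' j' h h' hlt => ?_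
  simp only [Option.ite_none_right_eq_some, Option.some.injEq] at h h'
  rw [← h.2, ← h'.2, Fin.mk_lt_mk]
  refine Finset.card_lt_card (Finset.ssubset_iff.2 ⟨j, by simp, ?_⟩)
  intro k hk
  simp only [Finset.mem_insert, Finset.mem_filter] at hk ⊢
  rcases hk with rfl | hk
  · exact ⟨h.1, hlt⟩
  · exact ⟨hk.1, hk.2.trans hlt⟩

open Classical in
theorem compat_minTransversalMap (η : Partn n) (u l : Fin n → Prop) :
    η.minTransversalMap.Compat u l ↔ ∀ j ∈ η.minTransversal, ∀ i : Fin n,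
      (i : ℕ) = (η.minTransversal.filter (· < j)).card → (u i ↔ l j) := by
  rw [minTransversalMap, compat_ofPartialMap]
  simp only [Option.ite_none_right_eq_some, Option.some.injEq, Fin.ext_iff]
  exact ⟨fun h j hj i hi => h i j ⟨hj, hi.symm⟩, fun h i j hij => h j hij.1 i hij.2.symm⟩

open Classical in
theorem index_minTransversal_lt {η : Partn n} (h4 : η.rank ≤ 2) {j : Fin n}
    (hj : j ∈ η.minTransversal) : (η.minTransversal.filter (· < j)).card < 2 := by
  refine lt_of_lt_of_le (Finset.card_lt_card ?_) ((card_minTransversal_le η).trans h4)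
  exact Finset.filter_ssubset.2 ⟨j, hj, lt_irrefl j⟩

/-- Distinct points of `η.minTransversal` lie in distinct blocks of `η`, so any subset of the upper
row extends to a union of blocks of the product. -/
theorem minTransversalMap_mul_ker {η : Partn n} {x y : Fin n}
    (h : (η.minTransversalMap * η).ker x y) : x = y := by
  classical
  have hle : (η.minTransversalMap * η).ker ≤ η.minTransversalMap.ker := by
    rw [ker_le_iff]
    rintro u -
    obtain ⟨l, hl⟩ := (exists_compat_iff η fun x => ∃ j ∈ η.minTransversal, η.ker x j ∧
        ∃ i : Fin n, (i : ℕ) = (η.minTransversal.filter (· < j)).card ∧ u i).2 (by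
      intro x y hxy
      exact ⟨fun ⟨z, hz, h1, h2⟩ => ⟨z, hz, η.ker.trans' (η.ker.symm' hxy) h1, h2⟩,
        fun ⟨z, hz, h1, h2⟩ => ⟨z, hz, η.ker.trans' hxy h1, h2⟩⟩)
    refine ⟨l, (compat_mul _ _ _ _).2 ⟨_, ?_, hl⟩⟩
    rw [compat_minTransversalMap]
    intro j hj i hi
    refine ⟨fun hu => ⟨j, hj, η.ker.refl' j, i, hi, hu⟩, ?_⟩
    rintro ⟨j', hj', h1, i', hi', hu⟩
    obtain rfl := eq_of_mem_minTransversal hj hj' h1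
    obtain rfl : i = i' := Fin.ext (hi.trans hi'.symm)
    exact hu
  have := hle h
  rwa [minTransversalMap, ker_ofPartialMap] at this

/-- Every transversal of the projection `η` contains `k` and `k'` for some `k` in
`η.minTransversal`, and the rank bound places the index of `k` in `S`. The conjugate therefore
links the two rows exactly as `η = η * η` does. -/
theorem conj_minTransversalMap {η : Partn n} (h2 : η * η = η) (h3 : star η = η)
    (h4 : η.rank ≤ 2) {S : Finset (Fin n)} (hS : ∀ i : Fin n, (i : ℕ) < 2 → i ∈ S) :
    star (η.minTransversalMap * η) * partialIdentity S * (η.minTransversalMap * η) = η := by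
  classical
  apply ext_compat
  intro u l
  have hsymm : ∀ p q, η.Compat p q ↔ η.Compat q p := fun p q => by
    rw [← compat_star, h3]
  simp only [compat_conj_partialIdentity, compat_mul η.minTransversalMap,
    compat_minTransversalMap]
  constructor
  · rintro ⟨m, m', ⟨p, hp, hpu⟩, ⟨q, hq, hql⟩, hmm⟩
    have hup := (hsymm _ _).1 hpu
    have cross : ∀ i j, η.rel (.inl i) (.inr j) → (u i ↔ l j) := by
      intro i j hij
      obtain ⟨k, hk, hik⟩ := exists_mem_minTransversal h2 h3 hij
      have hkk := (mem_minTransversal.1 hk).1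
      have hlt := index_minTransversal_lt h4 hk
      -- `t` is the upper vertex joined to the lower vertex `k` by `η.minTransversalMap`
      let t : Fin n := ⟨(η.minTransversal.filter (· < k)).card,
        (Finset.card_lt_univ_of_notMem (x := k) (by simp)).trans_eq (Fintype.card_fin n)⟩
      have hik' : u i ↔ u k := hup (.inl i) (.inl k) hik
      have e1 : u k ↔ p k := hup _ _ hkk
      have e2 : m t ↔ p k := hp k hk t rfl
      have e3 : m' t ↔ q k := hq k hk t rfl
      have e4 : q k ↔ l j := hql _ _ (η.rel.trans' (η.rel.symm' hik) hij)
      rw [hik', e1, ← e2, hmm t (hS t hlt), e3, e4]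
    rintro (a | a) (b | b) hab
    · exact hup (.inl a) (.inl b) hab
    · exact cross a b hab
    · exact (cross b a (η.rel.symm' hab)).symm
    · exact hql (.inr a) (.inr b) hab
  · intro h
    rw [← h2, compat_mul] at h
    obtain ⟨p, h5, h6⟩ := h
    let m : Fin n → Prop := fun i => ∃ j ∈ η.minTransversal,
      (i : ℕ) = (η.minTransversal.filter (· < j)).card ∧ p j
    have hm : ∀ j ∈ η.minTransversal, ∀ i : Fin n,
        (i : ℕ) = (η.minTransversal.filter (· < j)).card → (m i ↔ p j) := by
      intro j hj i hi
      refine ⟨?_, fun hp => ⟨j, hj, hi, hp⟩⟩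
      rintro ⟨j', hj', hi', hp⟩
      have hmono : ∀ a ∈ η.minTransversal, ∀ b, a < b →
          (η.minTransversal.filter (· < a)).card < (η.minTransversal.filter (· < b)).card := by
        intro a ha b hab
        refine Finset.card_lt_card (Finset.ssubset_iff.2 ⟨a, by simp, ?_⟩)
        intro k hk
        simp only [Finset.mem_insert, Finset.mem_filter] at hk ⊢
        rcases hk with rfl | hk
        · exact ⟨ha, hab⟩
        · exact ⟨hk.1, hk.2.trans hab⟩
      rcases lt_trichotomy j j' with hlt | rfl | hlt
      · have := hmono j hj j' hlt; omega
      · exact hp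
      · have := hmono j' hj' j hlt; omega
    exact ⟨m, m, ⟨p, hm, (hsymm _ _).1 h5⟩, ⟨p, hm, h6⟩, fun _ _ => Iff.rfl⟩

end Partn

/-! ### The action on projections -/

namespace StarSubmonoid

open Partn

variable {n : ℕ} {M : StarSubmonoid n}

theorem projectionAction_eq_some {ε : M.lowProjections} {α : M.toSubmonoid}
    (h : (ε : Partn n).ker = ((ε : Partn n) * (α : Partn n)).ker) :
    M.projectionAction.act (some ε) α =
      some ⟨star (α : Partn n) * ε * α, M.conj_mem ε.2 α.2⟩ := if_pos h

theorem projectionAction_eq_none {ε : M.lowProjections} {α : M.toSubmonoid} :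
    M.projectionAction.act (some ε) α = none ↔
      (ε : Partn n).ker ≠ ((ε : Partn n) * (α : Partn n)).ker := by
  by_cases h : (ε : Partn n).ker = ((ε : Partn n) * (α : Partn n)).ker
  · simp [projectionAction_eq_some h, h]
  · exact ⟨fun _ => h, fun _ => if_neg h⟩

theorem partialIdentity_mem
    (hM : ∀ α : Partn n, α.IsPlanar ∧ α.IsPartialBrauer → α ∈ M.toSubmonoid)
    {S : Finset (Fin n)} (hS : S.card ≤ 2) : partialIdentity S ∈ M.lowProjections :=
  ⟨hM _ (partialIdentity_motzkin S), partialIdentity_mul_self S, star_partialIdentity S,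
    (rank_partialIdentity_le S).trans hS⟩

theorem faithful_projectionAction
    (hM : ∀ α : Partn n, α.IsPlanar ∧ α.IsPartialBrauer → α ∈ M.toSubmonoid) :
    M.projectionAction.Faithful := by
  have main : ∀ α β : M.toSubmonoid,
      (∀ x, M.projectionAction.act x α = M.projectionAction.act x β) →
      ∀ x y, (α : Partn n).rel x y → (β : Partn n).rel x y := by
    intro α β h
    have hker : ∀ S : Finset (Fin n), S.card ≤ 2 →
        ((∀ x ∈ S, ∀ y ∈ S, (α : Partn n).ker x y → x = y) ↔
          ∀ x ∈ S, ∀ y ∈ S, (β : Partn n).ker x y → x = y) := by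
      intro S hS
      have hx := h (some ⟨_, partialIdentity_mem hM hS⟩)
      have h1 := projectionAction_eq_none (ε := ⟨_, partialIdentity_mem hM hS⟩) (α := α)
      rw [hx, projectionAction_eq_none] at h1
      rw [← ker_partialIdentity_mul_iff, ← ker_partialIdentity_mul_iff]
      exact (not_iff_not.1 h1).symm
    have hconj : ∀ S : Finset (Fin n), S.card ≤ 1 →
        star (α : Partn n) * partialIdentity S * α =
          star (β : Partn n) * partialIdentity S * β := by
      intro S hS
      have hx := h (some ⟨_, partialIdentity_mem hM (hS.trans one_le_two)⟩)
      have hsub : ∀ γ : Partn n, ∀ x ∈ S, ∀ y ∈ S, γ.ker x y → x = y :=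
        fun _ x hx y hy _ => Finset.card_le_one.1 hS x hx y hy
      rw [projectionAction_eq_some ((ker_partialIdentity_mul_iff _ _).2 (hsub _)),
        projectionAction_eq_some ((ker_partialIdentity_mul_iff _ _).2 (hsub _))] at hx
      exact congrArg Subtype.val (Option.some.inj hx)
    have hcross : ∀ i j, (α : Partn n).rel (.inl i) (.inr j) →
        (β : Partn n).rel (.inl i) (.inr j) := by
      intro i j hij
      rwa [← conj_partialIdentity_singleton_rel, hconj {i} (by simp),
        conj_partialIdentity_singleton_rel] at hij
    rintro (i | i) (j | j) hij
    · change (β : Partn n).ker i j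
      by_contra hne
      have hij' : i ≠ j := fun e => hne (e ▸ Setoid.refl' _ _)
      refine hij' ((hker {i, j} Finset.card_le_two).2 ?_ i (by simp) j (by simp) hij)
      intro x hx y hy hxy
      simp only [Finset.mem_insert, Finset.mem_singleton] at hx hy
      rcases hx with rfl | rfl <;> rcases hy with rfl | rfl
      · rfl
      · exact absurd hxy hne
      · exact absurd (Setoid.symm' _ hxy) hne
      · rfl
    · exact hcross i j hij
    · exact Setoid.symm' _ (hcross j i (Setoid.symm' _ hij))
    · rwa [← conj_partialIdentity_empty_rel, hconj ∅ (by simp),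
        conj_partialIdentity_empty_rel] at hij
  intro α β h
  have h : ∀ x, M.projectionAction.act x α = M.projectionAction.act x β := congrFun h
  exact Subtype.ext (Partn.ext (Setoid.ext fun x y =>
    ⟨main α β h x y, main β α (fun x => (h x).symm) x y⟩))

theorem exists_surjective_projectionAction (hn : 2 ≤ n)
    (hM : ∀ α : Partn n, α.IsPlanar ∧ α.IsPartialBrauer → α ∈ M.toSubmonoid) :
    ∃ x, Function.Surjective (M.projectionAction.act x) := by
  let a : Fin n := ⟨0, by omega⟩
  let b : Fin n := ⟨1, by omega⟩
  have hab : a ≠ b := by simp [a, b, Fin.ext_iff]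
  refine ⟨some ⟨_, partialIdentity_mem hM (S := {a, b}) Finset.card_le_two⟩, ?_⟩
  rintro (_ | ⟨η, hη, h2, h3, h4⟩)
  · refine ⟨⟨_, hM _ (upperHook_motzkin (a := a) (b := b) rfl)⟩, ?_⟩
    rw [projectionAction_eq_none, Ne, ker_partialIdentity_mul_iff]
    exact fun h => hab (h a (by simp) b (by simp) (upperHook_ker a b))
  · refine ⟨⟨_, mul_mem (hM _ η.minTransversalMap_motzkin) hη⟩, ?_⟩
    rw [projectionAction_eq_some ((ker_partialIdentity_mul_iff _ _).2
      fun x _ y _ h => minTransversalMap_mul_ker h)]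
    refine congrArg some (Subtype.ext (conj_minTransversalMap h2 h3 h4 fun i hi => ?_))
    simp only [a, b, Finset.mem_insert, Finset.mem_singleton, Fin.ext_iff]
    omega

end StarSubmonoid

end Diag

theorem theorem4p2 (n : ℕ) (hn : 2 ≤ n) (M : Diag.StarSubmonoid n)
    (hM : M = Diag.partitionMonoid n ∨ M = Diag.partialBrauerMonoid n ∨
      M = Diag.planarPartitionMonoid n ∨ M = Diag.motzkinMonoid n) :
    M.projectionAction.Faithful ∧ M.projectionAction.Monogenic ∧
      Diag.deg M.toSubmonoid ≤ Diag.degRC M.toSubmonoid ∧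
      Diag.degRC M.toSubmonoid ≤ ((1 + Nat.card M.lowProjections : ℕ) : ℕ∞) := by
  have hmot : ∀ α : Diag.Partn n, α.IsPlanar ∧ α.IsPartialBrauer → α ∈ M.toSubmonoid := by
    intro α hα
    rcases hM with rfl | rfl | rfl | rfl
    · exact trivial
    · exact hα.2
    · exact hα.1
    · exact hα
  have hfaith := Diag.StarSubmonoid.faithful_projectionAction hmot
  obtain ⟨x, hx⟩ := Diag.StarSubmonoid.exists_surjective_projectionAction hn hmot
  refine ⟨hfaith, ⟨x, Set.eq_univ_of_forall fun y => ?_⟩, Diag.deg_le_degRC _, ?_⟩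
  · obtain ⟨α, rfl⟩ := hx y
    exact Or.inr ⟨x, rfl, α, rfl⟩
  · refine iInf₂_le _ ⟨by omega, _, M.projectionAction, ?_, hfaith,
      M.projectionAction.isRightCongruenceAction_of_surjective x hx⟩
    rw [Finite.card_option, add_comm]
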